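/- A (left) nearfield is a set $R$ with an additive group structure $(R,+)$ and an associative multiplication such that $a(b+c)=ab+ac$ for all $a,b,c\in R$, $R\setminus\{0\}$ is a group under multiplication, and $0\cdot a=0$ for all $a$. It is proper if it is not right distributive, i.e. $(a+b)c\ne ac+bc$ for some $a,b,c\in R$. The nonempty additive subgroups $H$ of $R^m$ with $vr\in H$ for all $v\in H$, $r\in R$ (where $vr=(v_1r,\dots,v_mr)$) are called $R$-subgroups; $gen(V)$ is the intersection of all $R$-subgroups containing $V\subseteq R^m$, and $V$ is a seed set of $R^m$ if $gen(V)=R^m$. A set $V\subseteq R^m$ is $R$-linearly independent if $v\notin gen(V\setminus\{v\})$ for every $v\in V$. Let $R$ be a finite proper nearfield, $q=|R|$, and let $s_1,\dots,s_{q-2}$ be any enumeration of $R\setminus\{0,1\}$. For $m\ge 1$ let $V_m$ be the matrix over $R$ with $m$ columns produced by the following algorithm. Start with the $1\times 1$ matrix $K=(1)$ and $k=1$. As long as $K$ has fewer than $m$ columns: replace $k$ by $k+1$; if now $k=m$, let $K$ be the identity matrix $I_k$; otherwise delete the first $k-1$ columns of $K$, add a zero at the bottom of each remaining column, put the columns of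 $I_k$ in front of them, and then, for $c=1,\dots,k-1$ and, for each $c$, for $s=s_1,\dots,s_{q-2}$ in this order, append the column $(1,\dots,1,s,\dots,s)^T$ with $c$ entries $1$ followed by $k-c$ entries $s$, stopping as soon as $K$ has $m$ columns. Return $V_m=K$. Let $k=k(m)$ be the number of rows of $V_m$ and $S_m$ the set of its row vectors. Then for every $m\ge1$ the set $S_m$ is $R$-linearly independent; also, writing $v_1,\dots,v_k$ for the rows, $\sum_{i=1}^k v_ir_i=0$ with $r_i\in R$ only if all $r_i=0$. Moreover $gen(S_m)=R^m$, so $S_m$ is a seed set of $R^m$. It has exactly $$k(m)=\left\lceil\frac{q-4+\sqrt{q^2+8(q-2)m-8q+16}}{2(q-2)}\right\rceil$$ elements, and $k(m)\big/\sqrt{2m/(q-2)}\to1$ as $m\to\infty$. -/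

import Mathlib

open Filter Topology

/-- A (left) nearfield: an additive group (not assumed commutative) with an associative
multiplication which is distributive from the left and for which the nonzero elements form a
group. As usual the degenerate two-element structure with `0 * 1 = 1` is excluded: `0 * a = 0`. -/
class Nearfield (R : Type*) extends AddGroup R, GroupWithZero R where
  left_distrib : ∀ a b c : R, a * (b + c) = a * b + a * c

/-- A nearfield is proper if it is not right distributive (so it is not a division ring). -/
def IsProperNearfield (R : Type*) [Nearfield R] : Prop :=
  ∃ a b c : R, (a + b) * c ≠ a * c + b * c

/-! ### `R`-subgroups of `R^m`, with `R^m` modelled as `Fin m → R` -/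

section Subgroups

variable {R : Type*} [Nearfield R] {m : ℕ}

/-- The right scalar multiplication `v r` on the nearring module `R^m`. -/
def rsmul (v : Fin m → R) (r : R) : Fin m → R := fun j => v j * r

/-- A subgroup of `(R^m, +)` is an `R`-subgroup if it is closed under right scalar
multiplication. -/
def IsRSubgroup (H : AddSubgroup (Fin m → R)) : Prop :=
  ∀ v ∈ H, ∀ r : R, rsmul v r ∈ H

/-- `gen V` is the intersection of all `R`-subgroups of `R^m` containing `V`. -/
def gen (V : Set (Fin m → R)) : AddSubgroup (Fin m → R) :=
  sInf {H | IsRSubgroup H ∧ V ⊆ (H : Set (Fin m → R))}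

/-- `V` is a seed set of `T` if it generates `T`. -/
def IsSeedSet (V : Set (Fin m → R)) (T : AddSubgroup (Fin m → R)) : Prop :=
  gen V = T

/-- A set of vectors is `R`-linearly independent if none of its elements lies in the `R`-subgroup
generated by the others (that is, none is an iterated linear combination of the others). -/
def RLinearIndependent (V : Set (Fin m → R)) : Prop :=
  ∀ v ∈ V, v ∉ gen (V \ {v})

end Subgroups

/-! ### The algorithm -/

section Algorithm

variable {R : Type*} [Zero R] [One R]

/-- A matrix given by its number of rows and the list of its columns. -/
structure ColumnMatrix (R : Type*) where
  rows : ℕ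
  cols : List (Fin rows → R)

/-- The columns of the identity matrix of order `k`. -/
def identityColumns (k : ℕ) : List (Fin k → R) :=
  List.ofFn fun j : Fin k => Pi.single j 1

/-- The column of height `k` with entry `1` in rows `0, …, c` and entry `s` in rows
`c + 1, …, k - 1`. -/
def newColumn (k c : ℕ) (s : R) : Fin k → R :=
  fun i => if (i : ℕ) ≤ c then 1 else s

/-- The innermost loop: as long as there are fewer than `m` columns, run through the list of
scalars and append the corresponding new column. -/
def appendColumns (m k c : ℕ) : List R → List (Fin k → R) → List (Fin k → R)
  | [], K => K
  | s :: S, K => if K.length < m then appendColumns m k c S (K ++ [newColumn k c s]) else K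

/-- The loop over the counter `c = 0, …, k - 2`. -/
def counterLoop (S : List R) (m k : ℕ) (K : List (Fin k → R)) : List (Fin k → R) :=
  (List.range (k - 1)).foldl (fun K c => appendColumns m k c S K) K

/-- The body of the main loop: from a matrix with `k` rows to a matrix with `k + 1` rows.
The first `k` columns are replaced by the columns of the identity matrix of order `k + 1`, the
remaining columns get an additional entry `0` at the bottom, and then new columns are appended. -/
def seedStep (S : List R) (m : ℕ) (K : ColumnMatrix R) : ColumnMatrix R where
  rows := K.rows + 1
  cols :=
    if K.rows + 1 = m then identityColumns (K.rows + 1)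
    else counterLoop S m (K.rows + 1)
      (identityColumns (K.rows + 1) ++
        (K.cols.drop K.rows).map fun v => (Fin.snoc v 0 : Fin (K.rows + 1) → R))

theorem length_le_appendColumns (m k c : ℕ) (S : List R) (K : List (Fin k → R)) :
    K.length ≤ (appendColumns m k c S K).length := by
  induction S generalizing K with
  | nil => simp [appendColumns]
  | cons s S ih =>
    rw [appendColumns]
    split_ifs
    · exact le_trans (by simp) (ih _)
    · exact le_rfl

theorem appendColumns_length_le (m k c : ℕ) (S : List R) (K : List (Fin k → R))
    (h : K.length ≤ m) : (appendColumns m k c S K).length ≤ m := by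
  induction S generalizing K with
  | nil => simpa [appendColumns] using h
  | cons s S ih =>
    rw [appendColumns]
    split_ifs with h'
    · exact ih _ (by simpa using h')
    · exact h

theorem length_le_counterLoop (S : List R) (m k : ℕ) (K : List (Fin k → R)) :
    K.length ≤ (counterLoop S m k K).length := by
  unfold counterLoop
  generalize List.range (k - 1) = l
  induction l generalizing K with
  | nil => simp
  | cons c l ih => exact le_trans (length_le_appendColumns m k c S K) (ih _)

theorem counterLoop_length_le (S : List R) (m k : ℕ) (K : List (Fin k → R))
    (h : K.length ≤ m) : (counterLoop S m k K).length ≤ m := by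
  unfold counterLoop
  generalize List.range (k - 1) = l
  induction l generalizing K with
  | nil => simpa using h
  | cons c l ih => exact ih _ (appendColumns_length_le m k c S K h)

theorem length_lt_seedStep (S : List R) (m : ℕ) (K : ColumnMatrix R) (h : K.cols.length < m) :
    K.cols.length < (seedStep S m K).cols.length := by
  simp only [seedStep]
  split_ifs with h'
  · simp [identityColumns]; omega
  · refine lt_of_lt_of_le ?_ (length_le_counterLoop S m _ _)
    simp [identityColumns]; omega

theorem rows_le_seedStep (S : List R) (m : ℕ) (K : ColumnMatrix R) :
    (seedStep S m K).rows ≤ (seedStep S m K).cols.length := by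
  simp only [seedStep]
  split_ifs with h'
  · simp [identityColumns]
  · refine le_trans ?_ (length_le_counterLoop S m _ _)
    simp [identityColumns]

theorem seedStep_length_le (S : List R) (m : ℕ) (K : ColumnMatrix R)
    (h : K.cols.length < m) (hr : K.rows ≤ K.cols.length) :
    (seedStep S m K).cols.length ≤ m := by
  simp only [seedStep]
  split_ifs with h'
  · simp [identityColumns, h']
  · apply counterLoop_length_le
    simp [identityColumns]; omega

/-- The main loop, run as long as there are fewer than `m` columns. -/
def seedLoop (S : List R) (m : ℕ) (K : ColumnMatrix R) : ColumnMatrix R :=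
  if h : K.cols.length < m then seedLoop S m (seedStep S m K) else K
termination_by m - K.cols.length
decreasing_by
  have := length_lt_seedStep S m K h
  omega

/-- The output of the algorithm for the input `m`, where `S` lists `R \ {0, 1}`: the main loop
started at the matrix `(1)` (for `m = 1` the matrix `(1)` is returned at once). -/
def seedAlgorithm (S : List R) (m : ℕ) : ColumnMatrix R :=
  seedLoop S m ⟨1, [fun _ => 1]⟩

theorem seedLoop_length (S : List R) (m : ℕ) (K : ColumnMatrix R)
    (hm : K.cols.length ≤ m) (hr : K.rows ≤ K.cols.length) :
    (seedLoop S m K).cols.length = m := by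
  induction K using seedLoop.induct S m with
  | case1 K h ih =>
    rw [seedLoop, dif_pos h]
    exact ih (seedStep_length_le S m K h hr) (rows_le_seedStep S m K)
  | case2 K h =>
    rw [seedLoop, dif_neg h]
    omega

theorem seedAlgorithm_length (S : List R) {m : ℕ} (hm : 1 ≤ m) :
    (seedAlgorithm S m).cols.length = m :=
  seedLoop_length S m _ hm le_rfl

/-- The number of rows of the matrix `V_m`. -/
def seedRows (S : List R) (m : ℕ) : ℕ := (seedAlgorithm S m).rows

/-- The matrix `V_m` returned by the algorithm. -/
def seedMatrix (S : List R) {m : ℕ} (hm : 1 ≤ m) : Matrix (Fin (seedRows S m)) (Fin m) R :=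
  fun i j => (seedAlgorithm S m).cols.get (j.cast (seedAlgorithm_length S hm).symm) i

/-- The set `S_m` of row vectors of `V_m`. -/
def seedRowSet (S : List R) {m : ℕ} (hm : 1 ≤ m) : Set (Fin m → R) :=
  Set.range (seedMatrix S hm).row

end Algorithm

/-! ### Generation of `R^m` over a proper nearfield -/

section Generation

variable {R : Type*} [Nearfield R] {m : ℕ}

/-! Generation rests on a failure of right distributivity `(a + b)c ≠ ac + bc`. If `u`, `v` in an
`R`-subgroup are nonzero at `i`, scale them to have entries `a`, `b` there; the distributor `(x +
y)c - yc - xc` is nonzero at `i` and vanishes wherever `u` or `v` does. So once every ordered pair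
of coordinates is separated, all vectors supported at one coordinate are obtained, hence all of
`R^m` (`IsRSubgroup.eq_top_of_separating`). Rows separate coordinates as soon as no column is zero
or a left multiple of another (`gen_range_row_eq_top`). For columns with leading entry `1` this only
requires them to be distinct.

The unit columns kept in front give each row a private coordinate, whence both forms of
independence.

With `n = q - 2` scalars, an untruncated matrix with `k` rows has `k + n * k.choose 2` columns. The
loop stops at the first `k` for which this reaches `m`; solving the quadratic gives the ceiling and
the asymptotics. -/

theorem isRSubgroup_gen (V : Set (Fin m → R)) : IsRSubgroup (gen V) := by
  intro v hv r
  simp only [gen, AddSubgroup.mem_sInf] at hv ⊢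
  exact fun H hH => hH.1 v (hv H hH) r

theorem subset_gen (V : Set (Fin m → R)) : V ⊆ (gen V : Set (Fin m → R)) := by
  intro v hv
  simp only [gen, SetLike.mem_coe, AddSubgroup.mem_sInf]
  exact fun H hH => hH.2 hv

theorem gen_le {V : Set (Fin m → R)} {H : AddSubgroup (Fin m → R)} (hH : IsRSubgroup H)
    (hV : V ⊆ H) : gen V ≤ H :=
  sInf_le ⟨hH, hV⟩

theorem IsRSubgroup.exists_apply_eq {H : AddSubgroup (Fin m → R)} (hH : IsRSubgroup H)
    {v : Fin m → R} (hv : v ∈ H) {i : Fin m} (hi : v i ≠ 0) (x : R) :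
    ∃ u ∈ H, u i = x ∧ ∀ j, v j = 0 → u j = 0 :=
  ⟨rsmul v ((v i)⁻¹ * x), hH v hv _, by simp [rsmul, hi], fun j hj => by simp [rsmul, hj]⟩

/-- The distributor trick: over a proper nearfield, the sets of coordinates which can be
annihilated by an element with nonzero `i`-th coordinate are closed under unions. -/
theorem IsRSubgroup.exists_vanishing_union (hR : IsProperNearfield R)
    {H : AddSubgroup (Fin m → R)} (hH : IsRSubgroup H) {i : Fin m} {u v : Fin m → R}
    (hu : u ∈ H) (hv : v ∈ H) (hui : u i ≠ 0) (hvi : v i ≠ 0) :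
    ∃ w ∈ H, w i ≠ 0 ∧ ∀ j, u j = 0 ∨ v j = 0 → w j = 0 := by
  obtain ⟨a, b, c, habc⟩ := hR
  obtain ⟨x, hx, hxi, hx0⟩ := hH.exists_apply_eq hu hui a
  obtain ⟨y, hy, hyi, hy0⟩ := hH.exists_apply_eq hv hvi b
  -- Addition need not commute: subtracting `yc` before `xc` makes the expression equal to `(x + y)c
  -- - (xc + yc)`.
  refine ⟨rsmul (x + y) c + -rsmul y c + -rsmul x c,
    H.add_mem (H.add_mem (hH _ (H.add_mem hx hy) c) (H.neg_mem (hH _ hy c)))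
      (H.neg_mem (hH _ hx c)), ?_, ?_⟩
  · simp only [rsmul, Pi.add_apply, Pi.neg_apply, hxi, hyi]
    rw [add_assoc, ← neg_add_rev, ← sub_eq_add_neg]
    exact sub_ne_zero.mpr habc
  · rintro j (hj | hj)
    · simp [rsmul, hx0 j hj]
    · simp [rsmul, hy0 j hj]

theorem IsRSubgroup.eq_top_of_separating (hR : IsProperNearfield R)
    {H : AddSubgroup (Fin m → R)} (hH : IsRSubgroup H) (h0 : ∀ i, ∃ v ∈ H, v i ≠ 0)
    (hsep : ∀ i j, i ≠ j → ∃ v ∈ H, v i ≠ 0 ∧ v j = 0) : H = ⊤ := by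
  have key : ∀ (i : Fin m) (s : Finset (Fin m)), i ∉ s →
      ∃ v ∈ H, v i ≠ 0 ∧ ∀ j ∈ s, v j = 0 := by
    intro i s
    induction s using Finset.induction_on with
    | empty => intro _; simpa using h0 i
    | insert j s _ ih =>
      intro his
      rw [Finset.mem_insert, not_or] at his
      obtain ⟨u, hu, hui, hus⟩ := ih his.2
      obtain ⟨v, hv, hvi, hvj⟩ := hsep i j his.1
      obtain ⟨w, hw, hwi, hw0⟩ := hH.exists_vanishing_union hR hu hv hui hvi
      refine ⟨w, hw, hwi, fun l hl => hw0 l ?_⟩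
      rcases Finset.mem_insert.mp hl with rfl | hl
      · exact Or.inr hvj
      · exact Or.inl (hus l hl)
  rw [eq_top_iff]
  intro x _
  refine AddSubgroup.pi_mem_of_single_mem x fun i => ?_
  obtain ⟨v, hv, hvi, hv0⟩ := key i (Finset.univ.erase i) (by simp)
  obtain ⟨u, hu, hui, hu0⟩ := hH.exists_apply_eq hv hvi (x i)
  convert hu using 1
  ext j
  rcases eq_or_ne j i with rfl | hj
  · simp [hui]
  · simp [hj, hu0 j (hv0 j (by simp [hj]))]

/-- The rows of a matrix generate `R^m` if no column is a left multiple of another one and no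
column is zero. -/
theorem gen_range_row_eq_top (hR : IsProperNearfield R) {k : ℕ}
    (M : Matrix (Fin k) (Fin m) R) (h0 : ∀ j, ∃ l, M l j ≠ 0)
    (hM : ∀ i j, i ≠ j → ∀ a : R, ∃ l, M l i ≠ a * M l j) :
    gen (Set.range M.row) = ⊤ := by
  have hrow : ∀ l, M.row l ∈ gen (Set.range M.row) := fun l => subset_gen _ ⟨l, rfl⟩
  have hH := isRSubgroup_gen (Set.range M.row)
  refine hH.eq_top_of_separating hR (fun i => ?_) fun i j hij => ?_
  · obtain ⟨l, hl⟩ := h0 i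
    exact ⟨M.row l, hrow l, hl⟩
  · obtain ⟨l, hl⟩ := h0 j
    -- Row `l` is used to clear entry `j` of row `l'`; entry `i` survives exactly because column `i`
    -- differs at `l'` from this multiple of column `j`.
    obtain ⟨l', hl'⟩ := hM i j hij (M l i * (M l j)⁻¹)
    refine ⟨M.row l' + -rsmul (M.row l) ((M l j)⁻¹ * M l' j),
      AddSubgroup.add_mem _ (hrow l') (AddSubgroup.neg_mem _ (hH _ (hrow l) _)), ?_, ?_⟩
    · simp only [rsmul, Pi.add_apply, Pi.neg_apply, Matrix.row, ← mul_assoc]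
      rw [← sub_eq_add_neg]
      exact sub_ne_zero.mpr hl'
    · simp [rsmul, Matrix.row, hl]

/-! ### Independence from private columns -/

/-- A set of rows is `R`-linearly independent if each row has a private column. -/
theorem rLinearIndependent_range_row {k : ℕ} (M : Matrix (Fin k) (Fin m) R)
    (p : Fin k → Fin m) (hp : ∀ i l, M l (p i) = if l = i then 1 else 0) :
    RLinearIndependent (Set.range M.row) := by
  rintro _ ⟨i, rfl⟩ hi
  -- The vectors vanishing at the private coordinate of row `i` form an `R`-subgroup containing
  -- every other row but not row `i`.
  let H : AddSubgroup (Fin m → R) := (Pi.evalAddMonoidHom (fun _ => R) (p i)).ker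
  have hH : ∀ v, v ∈ H ↔ v (p i) = 0 := fun v => Iff.rfl
  have hle : gen (Set.range M.row \ {M.row i}) ≤ H := by
    refine gen_le (fun v hv r => ?_) ?_
    · rw [hH] at hv ⊢
      simp [rsmul, hv]
    · rintro _ ⟨⟨l, rfl⟩, hl⟩
      have hli : l ≠ i := by rintro rfl; exact hl rfl
      exact (hH _).mpr (by simp [Matrix.row, hp, hli])
  have := (hH _).mp (hle hi)
  simp [Matrix.row, hp] at this

/-- Sums are ordered lists because addition is not assumed commutative. -/
theorem List.sum_ofFn_eq_of_forall_ne {A : Type*} [AddMonoid A] {k : ℕ} (f : Fin k → A)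
    (i : Fin k) (hf : ∀ j, j ≠ i → f j = 0) : (List.ofFn f).sum = f i := by
  induction k with
  | zero => exact i.elim0
  | succ k ih =>
    rw [List.ofFn_succ, List.sum_cons]
    cases i using Fin.cases with
    | zero =>
      rw [List.sum_eq_zero, add_zero]
      intro x hx
      obtain ⟨j, rfl⟩ := (List.mem_ofFn' _ _).mp hx
      exact hf _ (Fin.succ_ne_zero j)
    | succ i =>
      rw [hf 0 (Fin.succ_ne_zero i).symm, zero_add]
      exact ih _ i fun j hj => hf _ (by simpa using hj)

theorem eq_zero_of_sum_rsmul_row_eq_zero {k : ℕ} (M : Matrix (Fin k) (Fin m) R)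
    (p : Fin k → Fin m) (hp : ∀ i l, M l (p i) = if l = i then 1 else 0) (r : Fin k → R)
    (hr : (List.ofFn fun i => rsmul (M.row i) (r i)).sum = 0) (i : Fin k) : r i = 0 := by
  have h := congrArg (Pi.evalAddMonoidHom (fun _ => R) (p i)) hr
  rw [map_list_sum, List.map_ofFn, map_zero, List.sum_ofFn_eq_of_forall_ne _ i] at h
  · simpa [rsmul, Matrix.row, hp] using h
  · intro j hj
    simp [rsmul, Matrix.row, hp, hj]

theorem row_injective_of_private_column {k : ℕ} (M : Matrix (Fin k) (Fin m) R)
    (p : Fin k → Fin m) (hp : ∀ i l, M l (p i) = if l = i then 1 else 0) :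
    Function.Injective M.row := by
  intro i l h
  by_contra hil
  have := congrFun h (p i)
  simp [Matrix.row, hp, Ne.symm hil] at this

end Generation

/-! ### The columns produced by the algorithm -/

section Columns

variable {R : Type*}

/-- A column is normalized if its first nonzero entry is `1`. -/
def IsNormalizedColumn [Zero R] [One R] {k : ℕ} (w : Fin k → R) : Prop :=
  ∃ l, w l = 1 ∧ ∀ i < l, w i = 0

/-- Leading ones in different positions would give `1 = 0`; in the same position they force `a = 1`.
-/
theorem IsNormalizedColumn.eq_of_eq_mul [MulZeroOneClass R] [Nontrivial R] {k : ℕ}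
    {v w : Fin k → R} (hv : IsNormalizedColumn v) (hw : IsNormalizedColumn w) {a : R}
    (h : ∀ l, v l = a * w l) : v = w := by
  obtain ⟨i, hi, hi0⟩ := hv
  obtain ⟨j, hj, hj0⟩ := hw
  rcases lt_trichotomy i j with hij | rfl | hij
  · have := h i
    rw [hi, hj0 i hij, mul_zero] at this
    exact absurd this one_ne_zero
  · have := h i
    rw [hi, hj, mul_one] at this
    funext l
    rw [h l, ← this, one_mul]
  · have := h j
    rw [hi0 j hij, hj, mul_one] at this
    have h1 := h i
    rw [hi, ← this, zero_mul] at h1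
    exact absurd h1 one_ne_zero

/-! ### Closed forms of the truncated loops -/

theorem appendColumns_eq [One R] (m k c : ℕ) (S : List R) (K : List (Fin k → R)) :
    appendColumns m k c S K = K ++ (S.map (newColumn k c)).take (m - K.length) := by
  induction S generalizing K with
  | nil => simp [appendColumns]
  | cons s S ih =>
    rw [appendColumns]
    split_ifs with h
    · obtain ⟨d, hd⟩ : ∃ d, m - K.length = d + 1 := ⟨m - K.length - 1, by omega⟩
      have hd' : m - (K.length + 1) = d := by omega
      rw [ih, hd]
      simp [hd']
    · simp [Nat.sub_eq_zero_of_le (not_lt.mp h)]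

theorem counterLoop_eq [One R] (S : List R) (m k : ℕ) (K : List (Fin k → R)) :
    counterLoop S m k K =
      K ++ ((List.range (k - 1)).flatMap fun c => S.map (newColumn k c)).take
        (m - K.length) := by
  unfold counterLoop
  generalize List.range (k - 1) = l
  induction l generalizing K with
  | nil => simp
  | cons c l ih =>
    rw [List.foldl_cons, ih, appendColumns_eq, List.flatMap_cons, List.take_append,
      List.append_assoc]
    congr 3
    simp
    omega

theorem newColumn_last [One R] {k c : ℕ} (hc : c < k) (s : R) :
    newColumn (k + 1) c s (Fin.last k) = s := by
  simp [newColumn, hc]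

theorem nodup_newColumns [One R] {S : List R} (hS : S.Nodup) (hS1 : ∀ s ∈ S, s ≠ 1) (k : ℕ) :
    ((List.range k).flatMap fun c => S.map (newColumn (k + 1) c)).Nodup := by
  rw [List.nodup_flatMap]
  constructor
  · intro c hc
    refine hS.map_on fun s _ t _ h => ?_
    have := congrFun h (Fin.last k)
    rwa [newColumn_last (List.mem_range.mp hc), newColumn_last (List.mem_range.mp hc)] at this
  · refine (List.pairwise_lt_range (n := k)).imp_of_mem fun {c d} hc hd hcd => ?_
    rintro w hw hw'
    obtain ⟨s, hs, rfl⟩ := List.mem_map.mp hw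
    obtain ⟨t, ht, h⟩ := List.mem_map.mp hw'
    have hdk := List.mem_range.mp hd
    -- Row `d` is the last row where column type `d` still has its forced `1`, while type `c < d`
    -- already shows its scalar.
    have := congrFun h ⟨d, by omega⟩
    simp only [newColumn, le_refl, if_true, if_neg (not_le.mpr hcd)] at this
    exact hS1 s hs this.symm

/-! ### Column count and loop invariant -/

section ZeroOne

variable [Zero R] [One R]

/-- The number of columns of the untruncated matrix with `k` rows, for `n` scalars. -/
def fullColumnCount (n k : ℕ) : ℕ := k + n * k.choose 2

theorem fullColumnCount_succ (n k : ℕ) :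
    fullColumnCount n (k + 1) = fullColumnCount n k + 1 + k * n := by
  simp only [fullColumnCount, Nat.choose_succ_succ' k 1, Nat.choose_one_right]
  ring

theorem le_fullColumnCount (n k : ℕ) : k ≤ fullColumnCount n k :=
  Nat.le_add_right _ _

theorem isNormalizedColumn_single {k : ℕ} (j : Fin k) :
    IsNormalizedColumn (Pi.single j 1 : Fin k → R) :=
  ⟨j, by simp, fun i hi => by simp [hi.ne]⟩

theorem IsNormalizedColumn.snoc {k : ℕ} {w : Fin k → R} (hw : IsNormalizedColumn w) :
    IsNormalizedColumn (Fin.snoc w 0 : Fin (k + 1) → R) := by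
  obtain ⟨l, hl, hl0⟩ := hw
  refine ⟨l.castSucc, by simpa using hl, fun i hi => ?_⟩
  cases i using Fin.lastCases with
  | last => exact absurd hi (not_lt.mpr (Fin.le_last _))
  | cast i => simpa using hl0 i (by simpa using hi)

theorem isNormalizedColumn_newColumn (k c : ℕ) (s : R) :
    IsNormalizedColumn (newColumn (k + 1) c s) :=
  ⟨0, by simp [newColumn], fun i hi => absurd hi (Fin.not_lt_zero i)⟩

theorem mem_identityColumns {k : ℕ} {w : Fin k → R} :
    w ∈ identityColumns k ↔ ∃ j, Pi.single j 1 = w := by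
  rw [identityColumns, List.mem_ofFn']
  rfl

theorem getElem_identityColumns {k : ℕ} {i : ℕ}
    (hi : i < (identityColumns k : List (Fin k → R)).length) :
    (identityColumns k : List (Fin k → R))[i] =
      Pi.single ⟨i, by simpa [identityColumns] using hi⟩ 1 := by
  simp [identityColumns]

theorem nodup_identityColumns [NeZero (1 : R)] (k : ℕ) :
    (identityColumns k : List (Fin k → R)).Nodup := by
  rw [identityColumns, List.nodup_ofFn]
  intro i j h
  by_contra hij
  have := congrFun h i
  simp [hij] at this

/-- The invariant of the main loop. -/
structure SeedInvariant (S : List R) (m : ℕ) (K : ColumnMatrix R) : Prop where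
  rows_pos : 1 ≤ K.rows
  isPrefix : identityColumns K.rows <+: K.cols
  nodup : K.cols.Nodup
  normalized : ∀ w ∈ K.cols, IsNormalizedColumn w
  count_pred_lt : fullColumnCount S.length (K.rows - 1) < m
  length_eq : K.cols.length = min m (fullColumnCount S.length K.rows)

theorem seedInvariant_init (S : List R) {m : ℕ} (hm : 1 ≤ m) :
    SeedInvariant S m ⟨1, [fun _ => 1]⟩ where
  rows_pos := le_rfl
  isPrefix := by
    have : (identityColumns 1 : List (Fin 1 → R)) = [fun _ => 1] := by
      simp only [identityColumns, List.ofFn_succ, List.ofFn_zero, List.cons.injEq, and_true]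
      funext i
      rw [Subsingleton.elim i 0]
      simp
    exact this ▸ List.prefix_refl _
  nodup := by simp
  normalized := by
    intro w hw
    rw [List.mem_singleton.mp hw]
    exact ⟨0, rfl, fun i hi => absurd hi (Fin.not_lt_zero i)⟩
  count_pred_lt := by simpa [fullColumnCount] using Nat.pos_of_ne_zero (by omega)
  length_eq := by simp [fullColumnCount, hm]

theorem SeedInvariant.step [NeZero (1 : R)] {S : List R} (hS : S.Nodup)
    (hS01 : ∀ s ∈ S, s ≠ 0 ∧ s ≠ 1) {m : ℕ} {K : ColumnMatrix R} (hK : SeedInvariant S m K)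
    (hlt : K.cols.length < m) : SeedInvariant S m (seedStep S m K) := by
  obtain ⟨k, cols⟩ := K
  obtain ⟨hk, hprefix, hnodup, hnorm, hpred, hlen⟩ := hK
  dsimp only at hk hprefix hnodup hnorm hpred hlen hlt
  obtain ⟨L, rfl⟩ := hprefix
  have hidlen : ∀ n, (identityColumns n : List (Fin n → R)).length = n := by
    simp [identityColumns]
  rw [List.length_append, hidlen] at hlen hlt
  -- Fewer than `m` columns means that nothing has been truncated so far.
  have hcount : k + L.length = fullColumnCount S.length k := by omega
  have hsucc := fullColumnCount_succ S.length k
  have hle := le_fullColumnCount S.length (k + 1)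
  -- In the shortcut case `k + L.length < k + 1`, so `L` is empty and resetting to the identity
  -- discards nothing.
  by_cases hkm : k + 1 = m
  · have hcols : seedStep S m ⟨k, identityColumns k ++ L⟩ =
        ⟨k + 1, identityColumns (k + 1)⟩ := by
      simp [seedStep, hkm]
    rw [hcols]
    exact
      { rows_pos := by simp
        isPrefix := List.prefix_refl _
        nodup := nodup_identityColumns _
        normalized := fun w hw => by
          obtain ⟨j, rfl⟩ := mem_identityColumns.mp hw
          exact isNormalizedColumn_single j
        count_pred_lt := by dsimp only; rw [Nat.add_sub_cancel]; omega
        length_eq := by dsimp only; rw [hidlen]; omega }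
  have hcols : seedStep S m ⟨k, identityColumns k ++ L⟩ =
      ⟨k + 1, identityColumns (k + 1) ++ (L.map fun v => (Fin.snoc v 0 : Fin (k + 1) → R)) ++
        ((List.range k).flatMap fun c => S.map (newColumn (k + 1) c)).take
          (m - (k + 1 + L.length))⟩ := by
    simp only [seedStep, hkm, if_false, counterLoop_eq, List.length_append, hidlen,
      List.length_map, Nat.add_sub_cancel]
    rw [List.drop_left' (hidlen k)]
  rw [hcols]
  refine
    { rows_pos := by simp
      isPrefix := ⟨_, (List.append_assoc _ _ _).symm⟩
      nodup := ?_
      normalized := ?_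
      count_pred_lt := by dsimp only; rw [Nat.add_sub_cancel]; omega
      length_eq := ?_ }
  -- New columns begin with `1` and end in a nonzero entry. Lifted columns end in `0`, and no unit
  -- vector of length `k + 1 ≥ 2` is nonzero at both ends.
  · have hnew : ∀ w ∈ ((List.range k).flatMap fun c => S.map (newColumn (k + 1) c)).take
          (m - (k + 1 + L.length)), w 0 = 1 ∧ w (Fin.last k) ≠ 0 := by
      intro w hw
      obtain ⟨c, hc, hw⟩ := List.mem_flatMap.mp (List.mem_of_mem_take hw)
      obtain ⟨s, hs, rfl⟩ := List.mem_map.mp hw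
      rw [newColumn_last (List.mem_range.mp hc)]
      exact ⟨by simp [newColumn], (hS01 s hs).1⟩
    obtain ⟨_, hL, hdisj⟩ := List.nodup_append'.mp hnodup
    refine List.nodup_append'.mpr ⟨List.nodup_append'.mpr
      ⟨nodup_identityColumns _, hL.map fun v w h => ?_, ?_⟩,
      (nodup_newColumns hS (fun s hs => (hS01 s hs).2) k).sublist (List.take_sublist _ _), ?_⟩
    · funext i
      simpa using congrFun h i.castSucc
    · intro w hw hw'
      obtain ⟨j, rfl⟩ := mem_identityColumns.mp hw
      obtain ⟨v, hv, h⟩ := List.mem_map.mp hw'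
      cases j using Fin.lastCases with
      | last => simpa using congrFun h (Fin.last k)
      | cast j =>
        -- Deleting the final `0` would put an old unit vector into the tail `L`.
        refine hdisj (mem_identityColumns.mpr ⟨j, ?_⟩) hv
        funext i
        have := congrFun h i.castSucc
        rw [Fin.snoc_castSucc] at this
        rw [this]
        simp [Pi.single_apply]
    · intro w hw hw'
      obtain ⟨h1, h2⟩ := hnew w hw'
      rcases List.mem_append.mp hw with hw | hw
      · obtain ⟨j, rfl⟩ := mem_identityColumns.mp hw
        have hj : (0 : Fin (k + 1)) = j := by
          by_contra hj
          simp [hj] at h1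
        subst hj
        refine h2 (Pi.single_eq_of_ne ?_ _)
        rw [Ne, Fin.ext_iff, Fin.val_last, Fin.val_zero]
        omega
      · obtain ⟨v, -, rfl⟩ := List.mem_map.mp hw
        exact h2 (by simp)
  · intro w hw
    rcases List.mem_append.mp hw with hw | hw
    · rcases List.mem_append.mp hw with hw | hw
      · obtain ⟨j, rfl⟩ := mem_identityColumns.mp hw
        exact isNormalizedColumn_single j
      · obtain ⟨v, hv, rfl⟩ := List.mem_map.mp hw
        exact (hnorm v (List.mem_append_right _ hv)).snoc
    · obtain ⟨c, _, hw⟩ := List.mem_flatMap.mp (List.mem_of_mem_take hw)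
      obtain ⟨s, _, rfl⟩ := List.mem_map.mp hw
      exact isNormalizedColumn_newColumn k c s
  · have hflat : ((List.range k).flatMap fun c => S.map (newColumn (k + 1) c)).length =
        k * S.length := by
      simp [List.length_flatMap]
    simp only [List.length_append, List.length_map, List.length_take, hidlen, hflat]
    omega

theorem SeedInvariant.seedLoop [NeZero (1 : R)] {S : List R} (hS : S.Nodup)
    (hS01 : ∀ s ∈ S, s ≠ 0 ∧ s ≠ 1) {m : ℕ} {K : ColumnMatrix R} (hK : SeedInvariant S m K) :
    SeedInvariant S m (seedLoop S m K) := by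
  induction K using seedLoop.induct S m with
  | case1 K h ih =>
    rw [_root_.seedLoop, dif_pos h]
    exact ih (hK.step hS hS01 h)
  | case2 K h => rwa [_root_.seedLoop, dif_neg h]

theorem seedInvariant_seedAlgorithm [NeZero (1 : R)] {S : List R} (hS : S.Nodup)
    (hS01 : ∀ s ∈ S, s ≠ 0 ∧ s ≠ 1) {m : ℕ} (hm : 1 ≤ m) :
    SeedInvariant S m (seedAlgorithm S m) :=
  (seedInvariant_init S hm).seedLoop hS hS01

theorem seedRows_le [NeZero (1 : R)] {S : List R} (hS : S.Nodup)
    (hS01 : ∀ s ∈ S, s ≠ 0 ∧ s ≠ 1) {m : ℕ} (hm : 1 ≤ m) : seedRows S m ≤ m := by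
  have h := (seedInvariant_seedAlgorithm hS hS01 hm).isPrefix.length_le
  rwa [seedAlgorithm_length S hm, identityColumns, List.length_ofFn] at h

/-- The leading identity block supplies the private columns. -/
theorem seedMatrix_castLE [NeZero (1 : R)] {S : List R} (hS : S.Nodup)
    (hS01 : ∀ s ∈ S, s ≠ 0 ∧ s ≠ 1) {m : ℕ} (hm : 1 ≤ m) (i l : Fin (seedRows S m)) :
    seedMatrix S hm l (i.castLE (seedRows_le hS hS01 hm)) = if l = i then 1 else 0 := by
  have h := (seedInvariant_seedAlgorithm hS hS01 hm).isPrefix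
  have hi : (i : ℕ) < (identityColumns (R := R) (seedAlgorithm S m).rows).length := by
    rw [identityColumns, List.length_ofFn]
    exact i.2
  have := h.getElem hi
  simp only [seedMatrix, List.get_eq_getElem, Fin.val_cast, Fin.val_castLE]
  rw [← this, getElem_identityColumns]
  exact Pi.single_apply _ _ _

end ZeroOne

end Columns

theorem gen_seedRowSet_eq_top {R : Type*} [Nearfield R] (hR : IsProperNearfield R) {S : List R}
    (hS : S.Nodup) (hS01 : ∀ s ∈ S, s ≠ 0 ∧ s ≠ 1) {m : ℕ} (hm : 1 ≤ m) :
    gen (seedRowSet S hm) = ⊤ := by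
  have hinv := seedInvariant_seedAlgorithm hS hS01 hm
  have hnorm : ∀ j, IsNormalizedColumn fun l => seedMatrix S hm l j :=
    fun j => hinv.normalized _ (List.get_mem _ _)
  refine gen_range_row_eq_top hR _ (fun j => ?_) fun i j hij a => ?_
  · obtain ⟨l, hl, -⟩ := hnorm j
    exact ⟨l, fun h => one_ne_zero (hl.symm.trans h)⟩
  · by_contra! h
    have heq := (hnorm i).eq_of_eq_mul (hnorm j) h
    exact hij (Fin.cast_injective _ (hinv.nodup.injective_get heq))

/-! ### The number of rows -/

theorem cast_fullColumnCount (n k : ℕ) :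
    2 * (fullColumnCount n k : ℝ) = 2 * k + n * (k * (k - 1)) := by
  rw [fullColumnCount]
  push_cast [Nat.cast_choose_two]
  ring

/-- The quotient is the positive root of `n x² - (n - 2) x = 2m`, whose left side is twice the
column count; the hypotheses place this root in `(k - 1, k]`. Completing the square turns them into
bounds on the square root. -/
theorem eq_ceil_of_fullColumnCount {n k m : ℕ} (hn : 1 ≤ n) (hk : 1 ≤ k)
    (h1 : fullColumnCount n (k - 1) < m) (h2 : m ≤ fullColumnCount n k) :
    (k : ℤ) = ⌈((n : ℝ) - 2 + √(((n : ℝ) - 2) ^ 2 + 8 * n * m)) / (2 * n)⌉ := by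
  obtain ⟨j, rfl⟩ : ∃ j, k = j + 1 := ⟨k - 1, by omega⟩
  rw [Nat.add_sub_cancel] at h1
  have hn' : (1 : ℝ) ≤ n := by exact_mod_cast hn
  have hn0 : (0 : ℝ) < 2 * n := by positivity
  have hj : (0 : ℝ) ≤ j := by positivity
  have h1' : 2 * (fullColumnCount n j : ℝ) < 2 * m := by gcongr
  have h2' : 2 * (m : ℝ) ≤ 2 * (fullColumnCount n (j + 1) : ℝ) := by gcongr
  rw [cast_fullColumnCount] at h1' h2'
  push_cast at h2'
  have h1n := mul_lt_mul_of_pos_left h1' hn0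
  have h2n := mul_le_mul_of_nonneg_left h2' hn0.le
  symm
  rw [Int.ceil_eq_iff, lt_div_iff₀ hn0, div_le_iff₀ hn0]
  push_cast
  constructor
  · have : 2 * (n : ℝ) * j - (n - 2) < √(((n : ℝ) - 2) ^ 2 + 8 * n * m) :=
      Real.lt_sqrt_of_sq_lt (by linarith)
    linarith
  · have : √(((n : ℝ) - 2) ^ 2 + 8 * n * m) ≤ 2 * (n : ℝ) * (j + 1) - (n - 2) := by
      refine Real.sqrt_le_iff.mpr ⟨?_, by linarith⟩
      have := mul_nonneg hn0.le hj
      linarith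
    linarith

/-! ### Asymptotics -/

theorem tendsto_ceil_div_sqrt {a : ℝ} (ha : 0 < a) {k : ℕ → ℕ}
    (hk : ∀ m, 1 ≤ m → (k m : ℤ) = ⌈(a - 2 + √((a - 2) ^ 2 + 8 * a * m)) / (2 * a)⌉) :
    Tendsto (fun m : ℕ => (k m : ℝ) / √(2 * m / a)) atTop (𝓝 1) := by
  have hd : Tendsto (fun m : ℕ => √(2 * m / a)) atTop atTop := by
    refine Real.tendsto_sqrt_atTop.comp ?_
    exact (tendsto_natCast_atTop_atTop.const_mul_atTop two_pos).atTop_div_const ha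
  -- With `d = √(2m/a)`, the root in the ceiling lies between `2ad` and `2ad + |a - 2|`. The
  -- argument of the ceiling is thus within `|a - 2| / a` of `d`, and rounding up costs at most `1`.
  have hbound : ∀ᶠ m : ℕ in atTop,
      ‖(k m : ℝ) / √(2 * m / a) - 1‖ ≤ (|a - 2| / a + 1) / √(2 * m / a) := by
    filter_upwards [hd.eventually_gt_atTop 0, eventually_ge_atTop 1] with m hpos hm
    set d := √(2 * m / a) with hd_def
    set D := √((a - 2) ^ 2 + 8 * a * m) with hD_def
    have hdsq : d ^ 2 = 2 * m / a := Real.sq_sqrt (by positivity)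
    have hD : (2 * a * d) ^ 2 = 8 * a * m := by
      rw [mul_pow, hdsq]; field_simp; ring
    have hlow : 2 * a * d ≤ D := Real.le_sqrt_of_sq_le (by rw [hD]; nlinarith [sq_nonneg (a - 2)])
    have hupp : D ≤ |a - 2| + 2 * a * d := by
      refine Real.sqrt_le_iff.mpr ⟨by positivity, ?_⟩
      rw [← hD, ← sq_abs (a - 2)]
      have : 0 ≤ |a - 2| * (2 * a * d) := by positivity
      linarith
    have hc := hk m hm
    have hc1 := Int.le_ceil ((a - 2 + D) / (2 * a))
    have hc2 := Int.ceil_lt_add_one ((a - 2 + D) / (2 * a))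
    rw [← hc, Int.cast_natCast] at hc1 hc2
    have hlow' : d - |a - 2| / a ≤ (a - 2 + D) / (2 * a) := by
      rw [le_div_iff₀ (by positivity), sub_mul]
      have : |a - 2| / a * (2 * a) = 2 * |a - 2| := by field_simp
      linarith [neg_abs_le (a - 2), abs_nonneg (a - 2)]
    have hupp' : (a - 2 + D) / (2 * a) ≤ d + |a - 2| / a := by
      rw [div_le_iff₀ (by positivity), add_mul]
      have : |a - 2| / a * (2 * a) = 2 * |a - 2| := by field_simp
      linarith [le_abs_self (a - 2)]
    rw [Real.norm_eq_abs, div_sub_one hpos.ne', abs_div, abs_of_pos hpos]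
    gcongr
    rw [abs_le]
    constructor <;> linarith
  have h0 := squeeze_zero_norm' hbound (hd.const_div_atTop _)
  simpa using h0.add_const 1

/-- A proper nearfield has an element besides `0` and `1`. -/
theorem IsProperNearfield.exists_ne_zero_ne_one {R : Type*} [Nearfield R]
    (hR : IsProperNearfield R) : ∃ x : R, x ≠ 0 ∧ x ≠ 1 := by
  obtain ⟨a, b, c, h⟩ := hR
  refine ⟨c, ?_, ?_⟩ <;> rintro rfl <;> simp at h

theorem length_add_two_eq_card {R : Type*} [MulZeroOneClass R] [Nontrivial R] [Fintype R]
    {S : List R} (hS_nodup : S.Nodup) (hS : ∀ x : R, x ∈ S ↔ x ≠ 0 ∧ x ≠ 1) :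
    S.length + 2 = Fintype.card R := by
  classical
  have hnd : (0 :: 1 :: S).Nodup := by simp [hS, hS_nodup]
  have huniv : (0 :: 1 :: S).toFinset = Finset.univ := by
    ext x
    by_cases h0 : x = 0 <;> by_cases h1 : x = 1 <;> simp [hS, h0, h1]
  rw [← Finset.card_univ, ← huniv, List.toFinset_card_of_nodup hnd]
  rfl

theorem mainTheorem1 {R : Type*} [Nearfield R] [Fintype R] (hR : IsProperNearfield R)
    (S : List R) (hS_nodup : S.Nodup) (hS : ∀ x : R, x ∈ S ↔ x ≠ 0 ∧ x ≠ 1) :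
    (∀ (m : ℕ) (hm : 1 ≤ m),
      RLinearIndependent (seedRowSet S hm) ∧
      (∀ r : Fin (seedRows S m) → R,
        (List.ofFn fun i => rsmul ((seedMatrix S hm).row i) (r i)).sum = 0 → ∀ i, r i = 0) ∧
      IsSeedSet (seedRowSet S hm) ⊤ ∧
      (seedRowSet S hm).ncard = seedRows S m ∧
      (seedRows S m : ℤ) =
        ⌈((Fintype.card R : ℝ) - 4 +
            √((Fintype.card R : ℝ) ^ 2 + 8 * ((Fintype.card R : ℝ) - 2) * m
              - 8 * (Fintype.card R : ℝ) + 16)) /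
          (2 * ((Fintype.card R : ℝ) - 2))⌉) ∧
    Tendsto (fun m : ℕ => (seedRows S m : ℝ) / √(2 * m / ((Fintype.card R : ℝ) - 2)))
      atTop (𝓝 1) := by
  have hS01 : ∀ s ∈ S, s ≠ 0 ∧ s ≠ 1 := fun s hs => (hS s).mp hs
  have hlen : 1 ≤ S.length := by
    obtain ⟨x, hx⟩ := hR.exists_ne_zero_ne_one
    exact List.length_pos_of_mem ((hS x).mpr hx)
  have hcard : (Fintype.card R : ℝ) = S.length + 2 := by
    rw [← length_add_two_eq_card hS_nodup hS]
    push_cast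
    rfl
  have hceil : ∀ m, 1 ≤ m → (seedRows S m : ℤ) =
      ⌈((S.length : ℝ) - 2 + √(((S.length : ℝ) - 2) ^ 2 + 8 * S.length * m)) /
        (2 * S.length)⌉ := by
    intro m hm
    have hinv := seedInvariant_seedAlgorithm hS_nodup hS01 hm
    have hm_le := hinv.length_eq
    rw [seedAlgorithm_length S hm] at hm_le
    exact eq_ceil_of_fullColumnCount hlen hinv.rows_pos hinv.count_pred_lt
      (hm_le.le.trans (min_le_right _ _))
  refine ⟨fun m hm => ?_, ?_⟩
  · have hp := seedMatrix_castLE hS_nodup hS01 hm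
    refine ⟨rLinearIndependent_range_row _ _ hp, eq_zero_of_sum_rsmul_row_eq_zero _ _ hp,
      gen_seedRowSet_eq_top hR hS_nodup hS01 hm, ?_, ?_⟩
    · rw [seedRowSet, ← Set.image_univ,
        Set.ncard_image_of_injective _ (row_injective_of_private_column _ _ hp),
        Set.ncard_univ, Nat.card_eq_fintype_card, Fintype.card_fin]
    · rw [hceil m hm, hcard]
      congr 1
      ring_nf
  · rw [hcard, add_sub_cancel_right]
    exact tendsto_ceil_div_sqrt (by exact_mod_cast hlen) hceil
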